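/- Let $E$ be the Euclidean plane with its standard tiling by unit equilateral triangles (tiles), and let $$X=\begin{pmatrix}0&1\\1&0\end{pmatrix},\qquad Y=\begin{pmatrix}0&-i\\i&0\end{pmatrix},\qquad Z=\begin{pmatrix}1&0\\0&-1\end{pmatrix}$$ be the Pauli matrices. A \emph{Pauli puzzle} is a marking of every tile by one of $X,Y,Z$ such that (1) tiles sharing an edge carry distinct matrices, and (2) at every vertex the cyclic product of the six matrices on the tiles around it is the identity matrix. Two Pauli puzzles are \emph{isomorphic} if some isometry of $E$ that preserves the tiling carries one marking to the other (the matrices being preserved). A (bi-infinite) \emph{1-strip} is the sequence of tiles lying between two neighbouring parallel lines of the tiling. A 1-strip, or a semi-infinite part of one, is a \emph{$T$-strip} if every three consecutive tiles in it carry the three matrices $X,Y,Z$ in some order. A puzzle is a \emph{union of parallel $T$-strips} (a $T$-puzzle) if, for one of the three directions of lines of the tiling, all bi-infinite 1-strips in that direction are $T$-strips. For $M\in\{X,Y,Z\}$, a \emph{Pauli $M$-puzzle} is a Pauli puzzle with a tile $t$ marked $M$ such that, in each of the three bi-infinite 1-strips through $t$, both semi-infinite strips starting at $t$ (and containing $t$)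 are $T$-strips, while the three consecutive tiles centred at $t$ avoid one of the Pauli matrices. \textbf{Theorem.} Every Pauli puzzle is either a Pauli $M$-puzzle for some $M\in\{X,Y,Z\}$ or a union of parallel $T$-strips. More precisely: (a) the four families ($X$-puzzles, $Y$-puzzles, $Z$-puzzles, unions of parallel $T$-strips) are pairwise disjoint, and no puzzle in one of them is isomorphic to a puzzle in another; (b) for each $M\in\{X,Y,Z\}$ there are, up to isomorphism, exactly two Pauli $M$-puzzles; (c) there are infinitely many pairwise nonisomorphic Pauli puzzles that are unions of parallel $T$-strips. -/

import Mathlib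

/-- The three Pauli matrices, as labels. -/
inductive Pauli : Type
  | X
  | Y
  | Z

namespace Pauli

/-- The complex `2 × 2` matrix named by a label. -/
def toMatrix : Pauli → Matrix (Fin 2) (Fin 2) ℂ
  | X => !![0, 1; 1, 0]
  | Y => !![0, -Complex.I; Complex.I, 0]
  | Z => !![1, 0; 0, -1]

end Pauli

/-- Vertices of the triangular lattice, in the basis `1, exp (π i / 3)` of the plane `ℂ`. -/
abbrev LatticeVertex : Type := ℤ × ℤ

/-- The point of the Euclidean plane `ℂ` with lattice coordinates `v = (a, b)`,
namely `a + b * exp (π i / 3)`. -/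
noncomputable def LatticeVertex.point (v : LatticeVertex) : ℂ :=
  ⟨(v.1 : ℝ) + (v.2 : ℝ) / 2, (v.2 : ℝ) * (Real.sqrt 3 / 2)⟩

/-- The unit equilateral triangles of the standard tiling of the plane.
`up a b` has corners `(a, b), (a + 1, b), (a, b + 1)`, and
`down a b` has corners `(a + 1, b), (a, b + 1), (a + 1, b + 1)`. -/
inductive Tile : Type
  | up (a b : ℤ)
  | down (a b : ℤ)

namespace Tile

/-- The three corners of a tile. -/
def corners : Tile → Finset LatticeVertex
  | up a b => {(a, b), (a + 1, b), (a, b + 1)}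
  | down a b => {(a + 1, b), (a, b + 1), (a + 1, b + 1)}

/-- The corners of a tile as points of the plane. -/
def cornerPoints (t : Tile) : Set ℂ :=
  LatticeVertex.point '' (t.corners : Set LatticeVertex)

/-- Two tiles are adjacent if they share an edge, i.e. have exactly two common corners. -/
def Adjacent (s t : Tile) : Prop :=
  (s.corners ∩ t.corners).card = 2

/-- The six tiles around a vertex, in counterclockwise order. -/
def around : LatticeVertex → List Tile
  | (a, b) => [up a b, down (a - 1) b, up (a - 1) b,
      down (a - 1) (b - 1), up a (b - 1), down a (b - 1)]

/-- The bi-infinite 1-strips, as sequences of consecutive tiles. A 1-strip consists of the tiles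
between two neighbouring parallel lattice lines; `d` is one of the three directions of lattice lines
and `n` says which of the parallel 1-strips in that direction is meant:
for `d = 0` the strip between the lines `b = n` and `b = n + 1`,
for `d = 1` the strip between the lines `a = n` and `a = n + 1`,
for `d = 2` the strip between the lines `a + b = n` and `a + b = n + 1`. -/
def strip (d : Fin 3) (n k : ℤ) : Tile :=
  match d with
  | 0 => if Even k then up (k / 2) n else down (k / 2) n
  | 1 => if Even k then up n (k / 2) else down n (k / 2)
  | 2 => if Even k then up (k / 2) (n - k / 2) else down (k / 2) (n - k / 2 - 1)

end Tile

/-- A Pauli puzzle: a marking of the tiles by Pauli matrices such that adjacent tiles carry distinct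
matrices and the cyclic product of the matrices around every vertex is the identity. -/
structure PauliPuzzle : Type where
  mark : Tile → Pauli
  mark_ne : ∀ s t : Tile, s.Adjacent t → mark s ≠ mark t
  prod_around : ∀ v : LatticeVertex,
    ((Tile.around v).map fun t => (mark t).toMatrix).prod = 1

namespace PauliPuzzle

/-- Isomorphism of puzzles: an isometry of the Euclidean plane that permutes the tiles and preserves
the Pauli matrices on them. (Isometries of the plane are affine, so that one maps a triangle onto
another if and only if it maps the corners of the first onto those of the second.) -/
def Isomorphic (p q : PauliPuzzle) : Prop :=
  ∃ (f : ℂ ≃ᵢ ℂ) (σ : Tile ≃ Tile),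
    (∀ t, f '' t.cornerPoints = (σ t).cornerPoints) ∧ ∀ t, q.mark (σ t) = p.mark t

/-- The part of the 1-strip `Tile.strip d n` with indices in `I` is a T-strip: any three consecutive
tiles in it carry the three Pauli matrices. Used for `I` an interval with at least three elements. -/
def IsTStripOn (p : PauliPuzzle) (d : Fin 3) (n : ℤ) (I : Set ℤ) : Prop :=
  ∀ k : ℤ, k ∈ I → k + 1 ∈ I → k + 2 ∈ I →
    ∀ M : Pauli, M = p.mark (Tile.strip d n k) ∨ M = p.mark (Tile.strip d n (k + 1)) ∨
      M = p.mark (Tile.strip d n (k + 2))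

/-- The puzzle is a union of parallel (bi-infinite) T-strips. -/
def IsUnionOfParallelTStrips (p : PauliPuzzle) : Prop :=
  ∃ d : Fin 3, ∀ n : ℤ, p.IsTStripOn d n Set.univ

/-- The Pauli `M`-puzzles: some tile `t` carries `M`, and each of the three bi-infinite 1-strips
through `t` is made of two semi-infinite T-strips that both start at `t` and go in opposite
directions, such that the segment of three tiles centred at `t` avoids one of the Pauli matrices. -/
def IsMPuzzle (M : Pauli) (p : PauliPuzzle) : Prop :=
  ∃ t : Tile, p.mark t = M ∧ ∀ (d : Fin 3) (n k : ℤ), Tile.strip d n k = t →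
    p.IsTStripOn d n (Set.Ici k) ∧ p.IsTStripOn d n (Set.Iic k) ∧
    ∃ N : Pauli, ∀ j ∈ Set.Icc (k - 1) (k + 1), p.mark (Tile.strip d n j) ≠ N

end PauliPuzzle

/-! Number the matrices by `ZMod 3`. Crossing an edge from its up tile to its down tile changes the
number by a nonzero amount. A finite check (`foldr_phaseMul_iff`) shows that six cyclically distinct
matrices multiply to the identity iff the differences on opposite edges at the vertex agree and the
three differences are not all equal. So the difference is constant along each lattice line, and a
puzzle is the same thing as a colouring of the lines by ±1 with no monochromatic concurrent triple,
together with the matrix on one tile.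

Such colourings obey a dichotomy. If the three sides of some tile have one colour, that tile's
neighbours all carry the same matrix (the tile is "uniform"). Concurrency then forces every other
line: each parallel class changes colour exactly once, at this tile (`IsLineColoring.eq_ite₀`), so
the tile is unique. If no tile is uniform, two parallel classes have constant, opposite colours
(`IsLineColoring.constant_pair`). Along a strip, tiles two apart agree iff the two lines between
them have equal colours (`mark_strip_eq_iff`). Hence the first case gives exactly the M-puzzles and
the second gives unions of parallel T-strips.

An isomorphism carries uniform tiles to uniform tiles and preserves the marks on the tile and its
neighbours. This separates the families. For given M it leaves only the choice of one of the two
other matrices for the neighbours. When two classes have opposite constant colours, the third may be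
coloured arbitrarily; this gives uncountably many T-puzzles, while each isomorphism class is
countable. -/

namespace Pauli

/-- The Pauli labels numbered by `ZMod 3`. -/
def code : Pauli → ZMod 3
  | X => 0
  | Y => 1
  | Z => 2

/-- The Pauli label with a given number. -/
def ofCode (c : ZMod 3) : Pauli :=
  if c = 0 then X else if c = 1 then Y else Z

@[simp] theorem ofCode_code (M : Pauli) : ofCode M.code = M := by
  cases M <;> rfl

@[simp] theorem code_ofCode : ∀ c : ZMod 3, (ofCode c).code = c := by decide

theorem code_injective : Function.Injective code :=
  Function.LeftInverse.injective ofCode_code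

/-! ### The vertex condition as arithmetic modulo 3 -/

/-- The Pauli matrices together with the identity matrix. -/
def optionMatrix : Option Pauli → Matrix (Fin 2) (Fin 2) ℂ
  | none => 1
  | some M => M.toMatrix

/-- Left multiplication by a Pauli matrix on the matrices `I ^ k • M`, where `M` is a Pauli matrix or
the identity matrix. -/
def phaseMul : Pauli → ℕ × Option Pauli → ℕ × Option Pauli
  | M, (k, none) => (k, some M)
  | X, (k, some X) => (k, none)
  | X, (k, some Y) => (k + 1, some Z)
  | X, (k, some Z) => (k + 3, some Y)
  | Y, (k, some X) => (k + 3, some Z)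
  | Y, (k, some Y) => (k, none)
  | Y, (k, some Z) => (k + 1, some X)
  | Z, (k, some X) => (k + 1, some Y)
  | Z, (k, some Y) => (k + 3, some X)
  | Z, (k, some Z) => (k, none)

/-- The matrix `I ^ k • M` described by a pair. -/
noncomputable def phaseMatrix (x : ℕ × Option Pauli) : Matrix (Fin 2) (Fin 2) ℂ :=
  Complex.I ^ x.1 • optionMatrix x.2

theorem toMatrix_mul_phaseMatrix (M : Pauli) (x : ℕ × Option Pauli) :
    M.toMatrix * phaseMatrix x = phaseMatrix (phaseMul M x) := by
  obtain ⟨k, _ | N⟩ := x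
  · simp [phaseMatrix, phaseMul, optionMatrix]
  · cases M <;> cases N <;> ext i j <;> fin_cases i <;> fin_cases j <;>
      simp [phaseMatrix, phaseMul, optionMatrix, toMatrix, Matrix.mul_apply, pow_add, mul_comm] <;>
      ring_nf <;> simp [Complex.I_sq]

theorem phaseMatrix_eq_one_iff (x : ℕ × Option Pauli) :
    phaseMatrix x = 1 ↔ x.1 % 4 = 0 ∧ x.2 = none := by
  obtain ⟨k, o⟩ := x
  have hk : Complex.I ^ k = Complex.I ^ (k % 4) := by
    conv_lhs => rw [← Nat.div_add_mod k 4, pow_add, pow_mul, Complex.I_pow_four, one_pow, one_mul]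
  have h4 : k % 4 < 4 := Nat.mod_lt _ (by norm_num)
  simp only [phaseMatrix, hk]
  generalize k % 4 = l at h4
  rw [← Matrix.ext_iff]
  rcases o with _ | M
  · interval_cases l <;> simp [Fin.forall_fin_two, optionMatrix, Complex.ext_iff] <;> norm_num
  · cases M <;> interval_cases l <;>
      simp [Fin.forall_fin_two, optionMatrix, toMatrix, Complex.ext_iff] <;> norm_num

theorem list_prod_eq_one_iff (l : List Pauli) :
    (l.map toMatrix).prod = 1 ↔
      (l.foldr phaseMul (0, none)).1 % 4 = 0 ∧ (l.foldr phaseMul (0, none)).2 = none := by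
  rw [← phaseMatrix_eq_one_iff]
  have h : ∀ l : List Pauli, (l.map toMatrix).prod = phaseMatrix (l.foldr phaseMul (0, none)) := by
    intro l
    induction l with
    | nil => simp [phaseMatrix, optionMatrix]
    | cons M l ih => simp [ih, toMatrix_mul_phaseMatrix]
  rw [h]

set_option synthInstance.maxSize 1000 in
set_option synthInstance.maxHeartbeats 200000 in
/-- The decidable form of the vertex condition. -/
theorem foldr_phaseMul_iff : ∀ c₀ c₁ c₂ c₃ c₄ c₅ : ZMod 3, c₁ - c₀ ≠ 0 → c₁ - c₂ ≠ 0 → c₃ - c₂ ≠ 0 →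
    c₃ - c₄ ≠ 0 → c₅ - c₄ ≠ 0 → c₅ - c₀ ≠ 0 →
    (((([c₀, c₁, c₂, c₃, c₄, c₅].map ofCode).foldr phaseMul (0, none)).1 % 4 = 0 ∧
      ((([c₀, c₁, c₂, c₃, c₄, c₅].map ofCode).foldr phaseMul (0, none)).2.isNone = true)) ↔
      c₅ - c₀ = c₃ - c₂ ∧ c₁ - c₀ = c₃ - c₄ ∧ c₁ - c₂ = c₅ - c₄ ∧
        (c₅ - c₀) + (c₁ - c₀) + (c₁ - c₂) ≠ 0) := by
  decide +kernel

theorem prod_six_eq_one_iff {m₀ m₁ m₂ m₃ m₄ m₅ : Pauli} (h₀ : m₁.code - m₀.code ≠ 0)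
    (h₁ : m₁.code - m₂.code ≠ 0) (h₂ : m₃.code - m₂.code ≠ 0) (h₃ : m₃.code - m₄.code ≠ 0)
    (h₄ : m₅.code - m₄.code ≠ 0) (h₅ : m₅.code - m₀.code ≠ 0) :
    ([m₀, m₁, m₂, m₃, m₄, m₅].map toMatrix).prod = 1 ↔
      m₅.code - m₀.code = m₃.code - m₂.code ∧ m₁.code - m₀.code = m₃.code - m₄.code ∧
      m₁.code - m₂.code = m₅.code - m₄.code ∧
      (m₅.code - m₀.code) + (m₁.code - m₀.code) + (m₁.code - m₂.code) ≠ 0 := by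
  rw [list_prod_eq_one_iff, ← foldr_phaseMul_iff _ _ _ _ _ _ h₀ h₁ h₂ h₃ h₄ h₅]
  simp only [List.map_cons, ofCode_code, List.map_nil, Option.isNone_iff_eq_none]

/-- Three consecutive tiles that avoid one matrix use only two, so they alternate. This turns the
definition of an M-puzzle into equality of the two outer tiles. -/
theorem eq_of_ne_of_avoid {A B C N : Pauli} (hA : A ≠ N) (hB : B ≠ N) (hC : C ≠ N) (hAB : B ≠ A)
    (hBC : B ≠ C) : A = C := by
  cases N <;> cases B <;> first | exact absurd rfl hB | skip
  all_goals cases A <;> first | exact absurd rfl hA | exact absurd rfl hAB | skip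
  all_goals cases C <;> first | exact absurd rfl hC | exact absurd rfl hBC | rfl

theorem exists_ne_ne (A B : Pauli) : ∃ C, A ≠ C ∧ B ≠ C := by
  have h : ∀ a b : ZMod 3, ∃ c, a ≠ c ∧ b ≠ c := by decide
  obtain ⟨c, ha, hb⟩ := h A.code B.code
  refine ⟨ofCode c, ?_, ?_⟩ <;> rintro rfl
  exacts [ha (code_ofCode c), hb (code_ofCode c)]

end Pauli

/-! ### Adjacency of tiles and coordinates along strips -/

namespace Tile

theorem adjacent_comm {s t : Tile} : s.Adjacent t ↔ t.Adjacent s := by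
  rw [Adjacent, Adjacent, Finset.inter_comm]

theorem not_adjacent_up_up (a b c d : ℤ) : ¬ (up a b).Adjacent (up c d) := by
  rw [Adjacent, ← Finset.filter_mem_eq_inter, Finset.card_filter, corners,
    Finset.sum_insert (by simp), Finset.sum_insert (by simp), Finset.sum_singleton]
  simp only [corners, Finset.mem_insert, Finset.mem_singleton, Prod.mk.injEq]
  split_ifs <;> (try simp only [not_false_eq_true]) <;> omega

theorem not_adjacent_down_down (a b c d : ℤ) : ¬ (down a b).Adjacent (down c d) := by
  rw [Adjacent, ← Finset.filter_mem_eq_inter, Finset.card_filter, corners,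
    Finset.sum_insert (by simp), Finset.sum_insert (by simp), Finset.sum_singleton]
  simp only [corners, Finset.mem_insert, Finset.mem_singleton, Prod.mk.injEq]
  split_ifs <;> (try simp only [not_false_eq_true]) <;> omega

theorem adjacent_up_down_iff {a b c d : ℤ} : (up a b).Adjacent (down c d) ↔
    c = a ∧ d = b - 1 ∨ c = a - 1 ∧ d = b ∨ c = a ∧ d = b := by
  rw [Adjacent, ← Finset.filter_mem_eq_inter, Finset.card_filter, corners,
    Finset.sum_insert (by simp), Finset.sum_insert (by simp), Finset.sum_singleton]
  simp only [corners, Finset.mem_insert, Finset.mem_singleton, Prod.mk.injEq]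
  split_ifs <;> (try simp only [false_iff]) <;> omega

theorem adjacent_down_up_iff {a b c d : ℤ} : (down a b).Adjacent (up c d) ↔
    c = a ∧ d = b + 1 ∨ c = a + 1 ∧ d = b ∨ c = a ∧ d = b := by
  rw [adjacent_comm, adjacent_up_down_iff]
  omega

theorem strip_zero_even (n x : ℤ) : strip 0 n (2 * x) = up x n := by
  simp [strip]

theorem strip_zero_odd (n x : ℤ) : strip 0 n (2 * x + 1) = down x n := by
  simp [strip, show (2 * x + 1) / 2 = x by omega]

theorem strip_one_even (n x : ℤ) : strip 1 n (2 * x) = up n x := by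
  simp [strip]

theorem strip_one_odd (n x : ℤ) : strip 1 n (2 * x + 1) = down n x := by
  simp [strip, show (2 * x + 1) / 2 = x by omega]

theorem strip_two_even (n x : ℤ) : strip 2 n (2 * x) = up x (n - x) := by
  simp [strip]

theorem strip_two_odd (n x : ℤ) : strip 2 n (2 * x + 1) = down x (n - x - 1) := by
  simp [strip, show (2 * x + 1) / 2 = x by omega]

theorem adjacent_strip_succ (d : Fin 3) (n k : ℤ) :
    (strip d n k).Adjacent (strip d n (k + 1)) := by
  obtain ⟨x, rfl | rfl⟩ := Int.even_or_odd' k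
  · fin_cases d <;>
      simp only [Fin.zero_eta, Fin.mk_one, Fin.reduceFinMk, strip_zero_even, strip_zero_odd,
        strip_one_even, strip_one_odd, strip_two_even, strip_two_odd, adjacent_up_down_iff] <;>
      simp
  · rw [show 2 * x + 1 + 1 = 2 * (x + 1) by ring]
    fin_cases d <;>
      simp only [Fin.zero_eta, Fin.mk_one, Fin.reduceFinMk, strip_zero_even, strip_zero_odd,
        strip_one_even, strip_one_odd, strip_two_even, strip_two_odd, adjacent_down_up_iff] <;>
      grind

theorem adjacent_strip_pred (d : Fin 3) (n k : ℤ) :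
    (strip d n k).Adjacent (strip d n (k - 1)) := by
  have h := adjacent_strip_succ d n (k - 1)
  rw [sub_add_cancel] at h
  exact adjacent_comm.1 h

/-- Every tile lies in a 1-strip of each direction. -/
theorem exists_strip_eq (d : Fin 3) (t : Tile) : ∃ n k, strip d n k = t := by
  rcases t with ⟨a, b⟩ | ⟨a, b⟩ <;> fin_cases d
  · exact ⟨b, 2 * a, strip_zero_even b a⟩
  · exact ⟨a, 2 * b, strip_one_even a b⟩
  · exact ⟨a + b, 2 * a, by simp [strip_two_even]⟩
  · exact ⟨b, 2 * a + 1, strip_zero_odd b a⟩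
  · exact ⟨a, 2 * b + 1, strip_one_odd a b⟩
  · exact ⟨a + b + 1, 2 * a + 1, by
      simp [strip_two_odd, show a + b + 1 - a - 1 = b by ring]⟩

end Tile

/-! ### Colourings of the lattice lines -/

/-- Three nowhere vanishing functions on the parallel classes of lattice lines, the lines with
indices `i, j, k` being concurrent when `i + j + k = 0`. The sum condition says that the three values
at a vertex are not all equal. -/
structure IsLineColoring (g₀ g₁ g₂ : ℤ → ZMod 3) : Prop where
  ne₀ : ∀ i, g₀ i ≠ 0
  ne₁ : ∀ i, g₁ i ≠ 0
  ne₂ : ∀ i, g₂ i ≠ 0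
  sum_ne : ∀ i j k, i + j + k = 0 → g₀ i + g₁ j + g₂ k ≠ 0

/-- Nonzero elements of `ZMod 3` are ±1, and three of them sum to zero exactly when they are equal.
So two equal colours at a vertex force the opposite colour on the third line. -/
theorem ZMod.eq_neg_of_add_add_ne_zero : ∀ {x y z c : ZMod 3}, x ≠ 0 → y ≠ 0 → x + y + z ≠ 0 → x = c →
    z = c → y = -c := by
  have h : ∀ y c : ZMod 3, c ≠ 0 → y ≠ 0 → c + y + c ≠ 0 → y = -c := by decide
  rintro x y z c hx hy hs rfl rfl
  exact h _ _ hx hy hs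

namespace IsLineColoring

variable {g₀ g₁ g₂ : ℤ → ZMod 3}

theorem rotate (h : IsLineColoring g₀ g₁ g₂) : IsLineColoring g₁ g₂ g₀ where
  ne₀ := h.ne₁
  ne₁ := h.ne₂
  ne₂ := h.ne₀
  sum_ne i j k hs := by
    rw [show g₁ i + g₂ j + g₀ k = g₀ k + g₁ i + g₂ j by ring]
    exact h.sum_ne _ _ _ (by omega)

/-- The half turn exchanges the index sums -1 and 1, that is, the sides of up tiles and those of
down tiles. -/
theorem reflect (h : IsLineColoring g₀ g₁ g₂) :
    IsLineColoring (fun i => g₀ (-i)) (fun i => g₁ (-i)) (fun i => g₂ (-i)) where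
  ne₀ i := h.ne₀ _
  ne₁ i := h.ne₁ _
  ne₂ i := h.ne₂ _
  sum_ne i j k hs := h.sum_ne _ _ _ (by omega)

theorem eq_neg₀ (h : IsLineColoring g₀ g₁ g₂) {i j k : ℤ} {c : ZMod 3} (hs : i + j + k = 0)
    (h₁ : g₁ j = c) (h₂ : g₂ k = c) : g₀ i = -c :=
  ZMod.eq_neg_of_add_add_ne_zero (h.ne₁ j) (h.ne₀ i)
    (by rw [show g₁ j + g₀ i + g₂ k = g₀ i + g₁ j + g₂ k by ring]; exact h.sum_ne i j k hs) h₁ h₂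

theorem eq_neg₁ (h : IsLineColoring g₀ g₁ g₂) {i j k : ℤ} {c : ZMod 3} (hs : i + j + k = 0)
    (h₀ : g₀ i = c) (h₂ : g₂ k = c) : g₁ j = -c :=
  h.rotate.eq_neg₀ (by omega) h₂ h₀

theorem eq_neg₂ (h : IsLineColoring g₀ g₁ g₂) {i j k : ℤ} {c : ZMod 3} (hs : i + j + k = 0)
    (h₀ : g₀ i = c) (h₁ : g₁ j = c) : g₂ k = -c :=
  h.rotate.rotate.eq_neg₀ (by omega) h₀ h₁

/-- Around a triangle of three equally coloured lines the colours of all lines are determined. -/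
theorem eq_ite₀ (h : IsLineColoring g₀ g₁ g₂) {i j k : ℤ} {c : ZMod 3} (hs : i + j + k = -1)
    (h₀ : g₀ i = c) (h₁ : g₁ j = c) (h₂ : g₂ k = c) (x : ℤ) :
    g₀ x = if x ≤ i then c else -c := by
  have h₁' : g₁ (j + 1) = -c := h.eq_neg₁ (by omega) h₀ h₂
  -- The induction zigzags between the neighbouring lines `j` and `j + 1` of the second class, which
  -- have opposite colours: a line of the third class is forced at one of them, and the next line of
  -- the first class at the other.
  have hup : ∀ n : ℕ, g₀ (i + 1 + n) = -c := by
    intro n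
    induction n with
    | zero => exact h.eq_neg₀ (by push_cast; omega) h₁ h₂
    | succ n ih =>
      have h₃ : g₂ (k - 1 - n) = - -c := h.eq_neg₂ (by omega) ih h₁'
      rw [neg_neg] at h₃
      exact h.eq_neg₀ (by push_cast; omega) h₁ h₃
  have hdown : ∀ n : ℕ, g₀ (i - n) = c := by
    intro n
    induction n with
    | zero => simpa using h₀
    | succ n ih =>
      have h₃ : g₂ (k + 1 + n) = -c := h.eq_neg₂ (by omega) ih h₁
      rw [← neg_neg c]
      exact h.eq_neg₀ (by push_cast; omega) h₁' h₃
  split_ifs with hx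
  · have := hdown (i - x).toNat
    rwa [show i - ((i - x).toNat : ℤ) = x by omega] at this
  · have := hup (x - (i + 1)).toNat
    rwa [show i + 1 + ((x - (i + 1)).toNat : ℤ) = x by omega] at this

theorem eq_ite₁ (h : IsLineColoring g₀ g₁ g₂) {i j k : ℤ} {c : ZMod 3} (hs : i + j + k = -1)
    (h₀ : g₀ i = c) (h₁ : g₁ j = c) (h₂ : g₂ k = c) (x : ℤ) :
    g₁ x = if x ≤ j then c else -c :=
  h.rotate.eq_ite₀ (by omega) h₁ h₂ h₀ x

theorem eq_ite₂ (h : IsLineColoring g₀ g₁ g₂) {i j k : ℤ} {c : ZMod 3} (hs : i + j + k = -1)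
    (h₀ : g₀ i = c) (h₁ : g₁ j = c) (h₂ : g₂ k = c) (x : ℤ) :
    g₂ x = if x ≤ k then c else -c :=
  h.rotate.rotate.eq_ite₀ (by omega) h₂ h₀ h₁ x

/-- A triangle of equally coloured lines is the only one. -/
theorem triangle_unique (h : IsLineColoring g₀ g₁ g₂) {i j k i' j' k' : ℤ}
    (hs : i + j + k = -1) (h₁ : g₁ j = g₀ i) (h₂ : g₂ k = g₀ i)
    (hs' : i' + j' + k' = -1 ∨ i' + j' + k' = 1) (h₁' : g₁ j' = g₀ i') (h₂' : g₂ k' = g₀ i') :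
    i' = i ∧ j' = j ∧ k' = k := by
  have hc : g₀ i ≠ -g₀ i := by
    have := h.ne₀ i
    generalize g₀ i = c at this
    revert c
    decide
  have e₀ := h.eq_ite₀ hs rfl h₁ h₂ i'
  rw [h.eq_ite₁ hs rfl h₁ h₂ j'] at h₁'
  rw [h.eq_ite₂ hs rfl h₁ h₂ k'] at h₂'
  rw [e₀] at h₁' h₂'
  -- Equal colours put all three lines on the same side of their switching points: either the index
  -- sum is at most -1, with equality only for the given triangle, or it is at least 2.
  split_ifs at h₁' h₂' <;> first
    | omega
    | exact absurd h₁' hc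
    | exact absurd h₁'.symm hc
    | exact absurd h₂' hc
    | exact absurd h₂'.symm hc

theorem exists_step {g : ℤ → ZMod 3} (hg : ¬ ∀ x, g x = g 0) : ∃ x, g (x + 1) ≠ g x := by
  contrapose! hg
  intro x
  induction x using Int.induction_on with
  | zero => rfl
  | succ n ih => rw [hg, ih]
  | pred n ih => rw [← ih, ← hg, sub_add_cancel]

/-- Without equally coloured triangles, two classes of lines cannot both be nonconstant. -/
theorem constant_or_constant (h : IsLineColoring g₀ g₁ g₂)
    (ht : ∀ i j k, i + j + k = -1 ∨ i + j + k = 1 → ¬ (g₁ j = g₀ i ∧ g₂ k = g₀ i)) :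
    (∀ x, g₀ x = g₀ 0) ∨ ∀ x, g₁ x = g₁ 0 := by
  by_contra! hcon
  obtain ⟨i, hi⟩ := exists_step (g := g₀) (by push Not; exact hcon.1)
  obtain ⟨j, hj⟩ := exists_step (g := g₁) (by push Not; exact hcon.2)
  -- The lines `i, i + 1` and `j, j + 1` bound a rhombus, and the third line is its diagonal. Both
  -- pairs have opposite colours, so whatever the colour of the diagonal, either one of the two
  -- triangles or one of the two vertices on the diagonal is monochromatic.
  have t₁ := ht i j (-(i + j + 1)) (by omega)
  have t₂ := ht (i + 1) (j + 1) (-(i + j + 1)) (by omega)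
  have t₃ := h.sum_ne i (j + 1) (-(i + j + 1)) (by omega)
  have t₄ := h.sum_ne (i + 1) j (-(i + j + 1)) (by omega)
  have n₁ := h.ne₀ i
  have n₂ := h.ne₀ (i + 1)
  have n₃ := h.ne₁ j
  have n₄ := h.ne₁ (j + 1)
  have n₅ := h.ne₂ (-(i + j + 1))
  generalize g₀ i = a at *
  generalize g₀ (i + 1) = b at *
  generalize g₁ j = c at *
  generalize g₁ (j + 1) = d at *
  generalize g₂ (-(i + j + 1)) = e at *
  clear hcon ht h
  revert a b c d e
  decide

/-- Without equally coloured triangles, two classes of lines have constant opposite colours. -/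
theorem constant_pair (h : IsLineColoring g₀ g₁ g₂)
    (ht : ∀ i j k, i + j + k = -1 ∨ i + j + k = 1 → ¬ (g₁ j = g₀ i ∧ g₂ k = g₀ i)) :
    (∀ x y, g₁ x ≠ g₂ y) ∨ (∀ x y, g₀ x ≠ g₂ y) ∨ (∀ x y, g₀ x ≠ g₁ y) := by
  have key : ∀ {f₀ f₁ f₂ : ℤ → ZMod 3}, IsLineColoring f₀ f₁ f₂ → (∀ x, f₀ x = f₀ 0) →
      (∀ x, f₁ x = f₁ 0) → (∀ x y, f₀ x ≠ f₁ y) ∨ ∀ x y, f₀ x ≠ f₂ y := by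
    intro f₀ f₁ f₂ hf h₀ h₁
    by_cases hc : f₀ 0 = f₁ 0
    · right
      intro x y
      -- If the two constant colours agree, every line of the third class meets them in a vertex, so
      -- it has the opposite colour.
      rw [hf.eq_neg₂ (i := 0) (j := -y) (by omega) rfl (by rw [h₁, hc]), h₀]
      have := hf.ne₀ 0
      generalize f₀ 0 = c at this
      revert c
      decide
    · left
      intro x y
      rwa [h₀, h₁]
  have c₀₁ := h.constant_or_constant ht
  have c₁₂ := h.rotate.constant_or_constant (by
    rintro i j k hs ⟨h₁, h₂⟩
    exact ht k i j (by omega) ⟨h₂.symm, by rw [h₁, h₂]⟩)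
  have c₂₀ := h.rotate.rotate.constant_or_constant (by
    rintro i j k hs ⟨h₁, h₂⟩
    exact ht j k i (by omega) ⟨by rw [h₁, h₂], h₁.symm⟩)
  have comm : ∀ {f f' : ℤ → ZMod 3}, (∀ x y, f x ≠ f' y) → ∀ x y, f' x ≠ f y :=
    fun hf x y => (hf y x).symm
  rcases c₀₁ with k₀ | k₁
  · rcases c₁₂ with k₁ | k₂
    · rcases key h k₀ k₁ with r | r <;> tauto
    · rcases key h.rotate.rotate k₂ k₀ with r | r
      · exact Or.inr (Or.inl (comm r))
      · exact Or.inl (comm r)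
  · rcases c₂₀ with k₂ | k₀
    · rcases key h.rotate k₁ k₂ with r | r
      · exact Or.inl r
      · exact Or.inr (Or.inr (comm r))
    · rcases key h k₀ k₁ with r | r <;> tauto

end IsLineColoring

/-! ### From puzzles to line colourings and back -/

open Tile

namespace PauliPuzzle

@[ext] theorem ext {p q : PauliPuzzle} (h : ∀ t, p.mark t = q.mark t) : p = q := by
  cases p; cases q
  congr
  exact funext h

/-- The number of the matrix on a tile. -/
def val (p : PauliPuzzle) (t : Tile) : ZMod 3 := (p.mark t).code

theorem val_eq_val_iff {p q : PauliPuzzle} {s t : Tile} :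
    p.val s = q.val t ↔ p.mark s = q.mark t :=
  Pauli.code_injective.eq_iff

theorem val_sub_ne_zero (p : PauliPuzzle) {s t : Tile} (h : s.Adjacent t) :
    p.val t - p.val s ≠ 0 := by
  rw [sub_ne_zero, Ne, val_eq_val_iff]
  exact (p.mark_ne s t h).symm

/-- The difference of the numbers on the two sides of the line `b = i`. -/
def color₀ (p : PauliPuzzle) (i : ℤ) : ZMod 3 := p.val (down 0 (i - 1)) - p.val (up 0 i)

/-- The difference of the numbers on the two sides of the line `a = i`. -/
def color₁ (p : PauliPuzzle) (i : ℤ) : ZMod 3 := p.val (down (i - 1) 0) - p.val (up i 0)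

/-- The difference of the numbers on the two sides of the line `a + b = -i`. -/
def color₂ (p : PauliPuzzle) (i : ℤ) : ZMod 3 := p.val (down 0 (-i - 1)) - p.val (up 0 (-i - 1))

theorem vertex_iff {m : Tile → Pauli}
    (hm : ∀ s t : Tile, s.Adjacent t → m s ≠ m t) (a b : ℤ) :
    ((around (a, b)).map fun t => (m t).toMatrix).prod = 1 ↔
      (m (down a (b - 1))).code - (m (up a b)).code =
        (m (down (a - 1) (b - 1))).code - (m (up (a - 1) b)).code ∧
      (m (down (a - 1) b)).code - (m (up a b)).code =
        (m (down (a - 1) (b - 1))).code - (m (up a (b - 1))).code ∧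
      (m (down (a - 1) b)).code - (m (up (a - 1) b)).code =
        (m (down a (b - 1))).code - (m (up a (b - 1))).code ∧
      ((m (down a (b - 1))).code - (m (up a b)).code) +
        ((m (down (a - 1) b)).code - (m (up a b)).code) +
        ((m (down (a - 1) b)).code - (m (up (a - 1) b)).code) ≠ 0 := by
  have key : ∀ {a b c d : ℤ}, (up a b).Adjacent (down c d) →
      (m (down c d)).code - (m (up a b)).code ≠ 0 := by
    intro a b c d h
    rw [sub_ne_zero, Pauli.code_injective.ne_iff]
    exact (hm _ _ h).symm
  rw [← Pauli.prod_six_eq_one_iff]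
  · simp [around]
  all_goals
    apply key
    rw [adjacent_up_down_iff]
    omega

theorem vertex (p : PauliPuzzle) (a b : ℤ) :
    p.val (down a (b - 1)) - p.val (up a b) =
      p.val (down (a - 1) (b - 1)) - p.val (up (a - 1) b) ∧
    p.val (down (a - 1) b) - p.val (up a b) =
      p.val (down (a - 1) (b - 1)) - p.val (up a (b - 1)) ∧
    p.val (down (a - 1) b) - p.val (up (a - 1) b) =
      p.val (down a (b - 1)) - p.val (up a (b - 1)) ∧
    (p.val (down a (b - 1)) - p.val (up a b)) + (p.val (down (a - 1) b) - p.val (up a b)) +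
      (p.val (down (a - 1) b) - p.val (up (a - 1) b)) ≠ 0 :=
  (vertex_iff p.mark_ne a b).1 (p.prod_around (a, b))

theorem _root_.Int.eq_zero_of_step {α : Type*} {f : ℤ → α} (h : ∀ x, f x = f (x - 1)) (x : ℤ) :
    f x = f 0 := by
  induction x using Int.induction_on with
  | zero => rfl
  | succ n ih => rw [h, add_sub_cancel_right, ih]
  | pred n ih => rw [← h, ih]

/-- Opposite edges at a vertex have equal differences, so the difference propagates along the whole
line; the next two lemmas do the same for the other directions. -/
theorem val_down_sub_one (p : PauliPuzzle) (a b : ℤ) :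
    p.val (down a (b - 1)) - p.val (up a b) = p.color₀ b :=
  Int.eq_zero_of_step (f := fun a => p.val (down a (b - 1)) - p.val (up a b))
    (fun x => (p.vertex x b).1) a

theorem val_sub_one_down (p : PauliPuzzle) (a b : ℤ) :
    p.val (down (a - 1) b) - p.val (up a b) = p.color₁ a :=
  Int.eq_zero_of_step (f := fun b => p.val (down (a - 1) b) - p.val (up a b))
    (fun x => (p.vertex a x).2.1) b

theorem val_down_sub_up (p : PauliPuzzle) (a b : ℤ) :
    p.val (down a b) - p.val (up a b) = p.color₂ (-(a + b + 1)) := by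
  have h := Int.eq_zero_of_step
    (f := fun x => p.val (down x (a + b - x)) - p.val (up x (a + b - x)))
    (fun x => by
      have := (p.vertex x (a + b + 1 - x)).2.2.1
      rw [show a + b + 1 - x - 1 = a + b - x by ring] at this
      rw [← this, show a + b - (x - 1) = a + b + 1 - x by ring]) a
  simp only [add_sub_cancel_left, sub_zero] at h
  rw [h, color₂, show - -(a + b + 1) - 1 = a + b by ring]

theorem isLineColoring (p : PauliPuzzle) : IsLineColoring p.color₀ p.color₁ p.color₂ where
  ne₀ i := p.val_sub_ne_zero (by rw [adjacent_up_down_iff]; omega)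
  ne₁ i := p.val_sub_ne_zero (by rw [adjacent_up_down_iff]; omega)
  ne₂ i := p.val_sub_ne_zero (by rw [adjacent_up_down_iff]; omega)
  sum_ne i j k hs := by
    have h := (p.vertex j i).2.2.2
    rwa [val_down_sub_one, val_sub_one_down, val_down_sub_up,
      show -(j - 1 + i + 1) = k by omega] at h

/-- A puzzle is determined by the matrix on one tile and the colours of the lines. -/
theorem eq_of_color_eq {p q : PauliPuzzle} (h₀ : p.color₀ = q.color₀) (h₁ : p.color₁ = q.color₁)
    (h₂ : p.color₂ = q.color₂) (h : p.mark (up 0 0) = q.mark (up 0 0)) : p = q := by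
  have hrow : ∀ a b, p.val (up a b) - q.val (up a b) = p.val (up 0 b) - q.val (up 0 b) := by
    intro a b
    refine Int.eq_zero_of_step (f := fun a => p.val (up a b) - q.val (up a b)) (fun x => ?_) a
    have e₁ := p.val_sub_one_down x b
    have e₂ := p.val_down_sub_up (x - 1) b
    have e₃ := q.val_sub_one_down x b
    have e₄ := q.val_down_sub_up (x - 1) b
    rw [h₁] at e₁
    rw [h₂] at e₂
    linear_combination e₂ - e₁ + e₃ - e₄
  have hcol : ∀ b, p.val (up 0 b) - q.val (up 0 b) = p.val (up 0 0) - q.val (up 0 0) := by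
    intro b
    refine Int.eq_zero_of_step (f := fun b => p.val (up 0 b) - q.val (up 0 b)) (fun x => ?_) b
    have e₁ := p.val_down_sub_one 0 x
    have e₂ := p.val_down_sub_up 0 (x - 1)
    have e₃ := q.val_down_sub_one 0 x
    have e₄ := q.val_down_sub_up 0 (x - 1)
    rw [h₀] at e₁
    rw [h₂] at e₂
    linear_combination e₂ - e₁ + e₃ - e₄
  have hup : ∀ a b, p.val (up a b) = q.val (up a b) := by
    intro a b
    have h' := val_eq_val_iff.2 h
    linear_combination hrow a b + hcol b + h'
  ext t
  rw [← val_eq_val_iff]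
  rcases t with ⟨a, b⟩ | ⟨a, b⟩
  · exact hup a b
  · have e₂ := p.val_down_sub_up a b
    have e₄ := q.val_down_sub_up a b
    rw [h₂] at e₂
    linear_combination e₂ - e₄ + hup a b

/-- The puzzle with prescribed increments along the three classes of lines. -/
def ofPotential (G₀ G₁ G₂ : ℤ → ZMod 3)
    (h : IsLineColoring (fun i => G₀ i - G₀ (i - 1)) (fun i => G₁ i - G₁ (i - 1))
      (fun i => G₂ (-i) - G₂ (-i - 1))) : PauliPuzzle :=
  let m : Tile → Pauli
    | up a b => Pauli.ofCode (G₂ (a + b) - G₁ a - G₀ b)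
    | down a b => Pauli.ofCode (G₂ (a + b + 1) - G₁ a - G₀ b)
  have hm' : ∀ a b c d : ℤ, (up a b).Adjacent (down c d) → m (up a b) ≠ m (down c d) := by
    intro a b c d hst
    rw [← Pauli.code_injective.ne_iff, ← sub_ne_zero, ← neg_ne_zero, neg_sub]
    simp only [m, Pauli.code_ofCode]
    rcases adjacent_up_down_iff.1 hst with ⟨rfl, rfl⟩ | ⟨rfl, rfl⟩ | ⟨rfl, rfl⟩
    · convert h.ne₀ b using 1
      rw [show c + (b - 1) + 1 = c + b by ring]
      ring
    · convert h.ne₁ a using 1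
      rw [show a - 1 + d + 1 = a + d by ring]
      ring
    · convert h.ne₂ (-(c + d + 1)) using 1
      rw [neg_neg, show c + d + 1 - 1 = c + d by ring]
      ring
  have hm : ∀ s t : Tile, s.Adjacent t → m s ≠ m t := by
    rintro (⟨a, b⟩ | ⟨a, b⟩) (⟨c, d⟩ | ⟨c, d⟩) hst
    · exact absurd hst (not_adjacent_up_up _ _ _ _)
    · exact hm' _ _ _ _ hst
    · exact (hm' _ _ _ _ (adjacent_comm.1 hst)).symm
    · exact absurd hst (not_adjacent_down_down _ _ _ _)
  { mark := m
    mark_ne := hm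
    prod_around := by
      rintro ⟨a, b⟩
      rw [vertex_iff hm]
      simp only [m, Pauli.code_ofCode]
      rw [show a + (b - 1) + 1 = a + b by ring, show a - 1 + b + 1 = a + b by ring,
        show a - 1 + (b - 1) + 1 = a + b - 1 by ring, show a - 1 + b = a + b - 1 by ring,
        show a + (b - 1) = a + b - 1 by ring]
      refine ⟨by ring, by ring, by ring, ?_⟩
      convert h.sum_ne b a (-(a + b)) (by ring) using 1
      rw [neg_neg]
      ring }

/-! ### Uniform tiles: monochromatic unit triangles of lines -/

/-- All neighbours of the tile carry the same matrix. -/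
def IsUniformAt (p : PauliPuzzle) (t : Tile) : Prop :=
  ∃ N, ∀ s, t.Adjacent s → p.mark s = N

theorem isUniformAt_iff_val {p : PauliPuzzle} {t : Tile} :
    p.IsUniformAt t ↔ ∃ c, ∀ s, t.Adjacent s → p.val s = c := by
  constructor
  · rintro ⟨N, h⟩
    exact ⟨N.code, fun s hs => by rw [val, h s hs]⟩
  · rintro ⟨c, h⟩
    exact ⟨Pauli.ofCode c, fun s hs => by rw [← h s hs, val, Pauli.ofCode_code]⟩

theorem isUniformAt_up_iff {p : PauliPuzzle} {a b : ℤ} : p.IsUniformAt (up a b) ↔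
    p.color₁ a = p.color₀ b ∧ p.color₂ (-(a + b + 1)) = p.color₀ b := by
  rw [isUniformAt_iff_val, ← val_sub_one_down p a b, ← val_down_sub_one p a b,
    ← val_down_sub_up p a b, sub_left_inj, sub_left_inj]
  constructor
  · rintro ⟨c, h⟩
    rw [h (down (a - 1) b), h (down a (b - 1)), h (down a b)]
    · simp
    all_goals rw [adjacent_up_down_iff]; omega
  · rintro ⟨h₁, h₂⟩
    refine ⟨p.val (down a (b - 1)), ?_⟩
    rintro (⟨c, d⟩ | ⟨c, d⟩) hs
    · exact absurd hs (not_adjacent_up_up _ _ _ _)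
    · rcases adjacent_up_down_iff.1 hs with ⟨rfl, rfl⟩ | ⟨rfl, rfl⟩ | ⟨rfl, rfl⟩
      exacts [rfl, h₁, h₂]

theorem isUniformAt_down_iff {p : PauliPuzzle} {a b : ℤ} : p.IsUniformAt (down a b) ↔
    p.color₁ (a + 1) = p.color₀ (b + 1) ∧ p.color₂ (-(a + b + 1)) = p.color₀ (b + 1) := by
  have e₀ := val_down_sub_one p a (b + 1)
  have e₁ := val_sub_one_down p (a + 1) b
  rw [add_sub_cancel_right] at e₀ e₁
  rw [isUniformAt_iff_val, ← e₀, ← e₁, ← val_down_sub_up p a b, sub_right_inj, sub_right_inj]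
  constructor
  · rintro ⟨c, h⟩
    rw [h (up (a + 1) b), h (up a (b + 1)), h (up a b)]
    · simp
    all_goals rw [adjacent_down_up_iff]; omega
  · rintro ⟨h₁, h₂⟩
    refine ⟨p.val (up a (b + 1)), ?_⟩
    rintro (⟨c, d⟩ | ⟨c, d⟩) hs
    · rcases adjacent_down_up_iff.1 hs with ⟨rfl, rfl⟩ | ⟨rfl, rfl⟩ | ⟨rfl, rfl⟩
      exacts [rfl, h₁, h₂]
    · exact absurd hs (not_adjacent_down_down _ _ _ _)

/-- At most one tile has neighbours that all carry the same matrix. -/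
theorem IsUniformAt.unique {p : PauliPuzzle} {s t : Tile} (hs : p.IsUniformAt s)
    (ht : p.IsUniformAt t) : s = t := by
  have key : ∀ {a b : ℤ}, p.IsUniformAt (up a b) → ∀ t, p.IsUniformAt t → t = up a b := by
    intro a b h t ht
    rw [isUniformAt_up_iff] at h
    rcases t with ⟨c, d⟩ | ⟨c, d⟩
    · rw [isUniformAt_up_iff] at ht
      have := p.isLineColoring.triangle_unique (by ring) h.1 h.2 (by omega) ht.1 ht.2
      rw [this.1, this.2.1]
    · rw [isUniformAt_down_iff] at ht
      have := p.isLineColoring.triangle_unique (by ring) h.1 h.2 (by omega) ht.1 ht.2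
      omega
  rcases s with ⟨a, b⟩ | ⟨a, b⟩
  · exact (key hs t ht).symm
  · rcases t with ⟨c, d⟩ | ⟨c, d⟩
    · exact key ht _ hs
    · rw [isUniformAt_down_iff] at hs ht
      -- Two down tiles become two up tiles after a half turn.
      have := p.isLineColoring.reflect.triangle_unique (i := -(b + 1)) (j := -(a + 1))
        (k := a + b + 1) (i' := -(d + 1)) (j' := -(c + 1)) (k' := c + d + 1) (by ring)
        (by simpa using hs.1) (by simpa using hs.2) (by omega) (by simpa using ht.1)
        (by simpa using ht.2)
      rw [show b = d by omega, show a = c by omega]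

/-! ### T-strips and M-puzzles in terms of line colours -/

theorem isTStripOn_iff {p : PauliPuzzle} {d : Fin 3} {n : ℤ} {I : Set ℤ} :
    p.IsTStripOn d n I ↔ ∀ k, k ∈ I → k + 1 ∈ I → k + 2 ∈ I →
      p.mark (strip d n k) ≠ p.mark (strip d n (k + 2)) := by
  have key : ∀ M₀ M₁ M₂ : Pauli, M₀ ≠ M₁ → M₁ ≠ M₂ →
      ((∀ M : Pauli, M = M₀ ∨ M = M₁ ∨ M = M₂) ↔ M₀ ≠ M₂) := by
    intro M₀ M₁ M₂ h₀ h₁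
    constructor
    · rintro h rfl
      have hX := h .X
      have hY := h .Y
      have hZ := h .Z
      cases M₀ <;> cases M₁ <;> simp_all
    · intro h₂ M
      cases M₀ <;> cases M₁ <;> cases M₂ <;> cases M <;> simp_all
  refine forall_congr' fun k => imp_congr_right fun _ => imp_congr_right fun _ =>
    imp_congr_right fun _ => key _ _ _ (p.mark_ne _ _ (adjacent_strip_succ d n k)) ?_
  have := adjacent_strip_succ d n (k + 1)
  rw [add_assoc] at this
  exact p.mark_ne _ _ this

/-- Two tiles at distance two in a 1-strip carry the same matrix if and only if the two lines
between them have the same colour. -/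
theorem mark_strip_eq_iff (p : PauliPuzzle) (n x : ℤ) :
    (p.mark (strip 0 n (2 * x)) = p.mark (strip 0 n (2 * x + 2)) ↔
      p.color₁ (x + 1) = p.color₂ (-(x + n + 1))) ∧
    (p.mark (strip 0 n (2 * x + 1)) = p.mark (strip 0 n (2 * x + 1 + 2)) ↔
      p.color₁ (x + 1) = p.color₂ (-(x + n + 2))) ∧
    (p.mark (strip 1 n (2 * x)) = p.mark (strip 1 n (2 * x + 2)) ↔
      p.color₀ (x + 1) = p.color₂ (-(x + n + 1))) ∧
    (p.mark (strip 1 n (2 * x + 1)) = p.mark (strip 1 n (2 * x + 1 + 2)) ↔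
      p.color₀ (x + 1) = p.color₂ (-(x + n + 2))) ∧
    (p.mark (strip 2 n (2 * x)) = p.mark (strip 2 n (2 * x + 2)) ↔
      p.color₀ (n - x) = p.color₁ (x + 1)) ∧
    (p.mark (strip 2 n (2 * x + 1)) = p.mark (strip 2 n (2 * x + 1 + 2)) ↔
      p.color₀ (n - x - 1) = p.color₁ (x + 1)) := by
  rw [show 2 * x + 1 + 2 = 2 * (x + 1) + 1 by ring, show 2 * x + 2 = 2 * (x + 1) by ring]
  simp only [strip_zero_even, strip_zero_odd, strip_one_even, strip_one_odd, strip_two_even,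
    strip_two_odd, ← val_eq_val_iff]
  refine ⟨?_, ?_, ?_, ?_, ?_, ?_⟩
  · rw [← p.val_sub_one_down (x + 1) n, ← p.val_down_sub_up x n, add_sub_cancel_right,
      sub_right_inj, eq_comm]
  · rw [← p.val_sub_one_down (x + 1) n, show x + n + 2 = x + 1 + n + 1 by ring,
      ← p.val_down_sub_up (x + 1) n, add_sub_cancel_right, sub_left_inj]
  · rw [← p.val_down_sub_one n (x + 1), show x + n + 1 = n + x + 1 by ring,
      ← p.val_down_sub_up n x, add_sub_cancel_right, sub_right_inj, eq_comm]
  · rw [← p.val_down_sub_one n (x + 1), show x + n + 2 = n + (x + 1) + 1 by ring,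
      ← p.val_down_sub_up n (x + 1), add_sub_cancel_right, sub_left_inj]
  · rw [← p.val_down_sub_one x (n - x), ← p.val_sub_one_down (x + 1) (n - x - 1),
      add_sub_cancel_right, sub_right_inj, show n - (x + 1) = n - x - 1 by ring]
  · rw [← p.val_down_sub_one (x + 1) (n - x - 1), ← p.val_sub_one_down (x + 1) (n - x - 1),
      add_sub_cancel_right, sub_left_inj, show n - (x + 1) - 1 = n - x - 1 - 1 by ring, eq_comm]

/-- Strips in two of the three directions through the tile already link all three of its neighbours.
-/
theorem IsMPuzzle.exists_isUniformAt {p : PauliPuzzle} {M : Pauli} (h : p.IsMPuzzle M) :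
    ∃ t, p.mark t = M ∧ p.IsUniformAt t := by
  obtain ⟨t, ht, h⟩ := h
  have key : ∀ d n k, strip d n k = t →
      p.mark (strip d n (k - 1)) = p.mark (strip d n (k + 1)) := by
    intro d n k hk
    obtain ⟨-, -, N, hN⟩ := h d n k hk
    have n₁ := hN (k - 1) (by simp; omega)
    have n₂ := hN k (by simp)
    have n₃ := hN (k + 1) (by simp; omega)
    have a₁ := p.mark_ne _ _ (adjacent_strip_pred d n k)
    have a₂ := p.mark_ne _ _ (adjacent_strip_succ d n k)
    exact Pauli.eq_of_ne_of_avoid n₁ n₂ n₃ a₁ a₂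
  refine ⟨t, ht, ?_⟩
  rcases t with ⟨a, b⟩ | ⟨a, b⟩
  · have k₀ := key 0 b (2 * a) (strip_zero_even _ _)
    have k₁ := key 1 a (2 * b) (strip_one_even _ _)
    rw [show 2 * a - 1 = 2 * (a - 1) + 1 by ring, strip_zero_odd, strip_zero_odd] at k₀
    rw [show 2 * b - 1 = 2 * (b - 1) + 1 by ring, strip_one_odd, strip_one_odd] at k₁
    refine ⟨p.mark (down a b), ?_⟩
    rintro (⟨c, d⟩ | ⟨c, d⟩) hs
    · exact absurd hs (not_adjacent_up_up _ _ _ _)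
    · rcases adjacent_up_down_iff.1 hs with ⟨rfl, rfl⟩ | ⟨rfl, rfl⟩ | ⟨rfl, rfl⟩
      exacts [k₁, k₀, rfl]
  · have k₀ := key 0 b (2 * a + 1) (strip_zero_odd _ _)
    have k₁ := key 1 a (2 * b + 1) (strip_one_odd _ _)
    rw [add_sub_cancel_right, show 2 * a + 1 + 1 = 2 * (a + 1) by ring, strip_zero_even,
      strip_zero_even] at k₀
    rw [add_sub_cancel_right, show 2 * b + 1 + 1 = 2 * (b + 1) by ring, strip_one_even,
      strip_one_even] at k₁
    refine ⟨p.mark (up a b), ?_⟩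
    rintro (⟨c, d⟩ | ⟨c, d⟩) hs
    · rcases adjacent_down_up_iff.1 hs with ⟨rfl, rfl⟩ | ⟨rfl, rfl⟩ | ⟨rfl, rfl⟩
      exacts [k₁.symm, k₀.symm, rfl]
    · exact absurd hs (not_adjacent_down_down _ _ _ _)

/-- The colours of the lines of a puzzle around a uniform tile. -/
theorem IsUniformAt.color_eq_up {p : PauliPuzzle} {a b : ℤ} (h : p.IsUniformAt (up a b)) :
    (∀ x, p.color₀ x = if x ≤ b then p.color₀ b else -p.color₀ b) ∧
    (∀ x, p.color₁ x = if x ≤ a then p.color₀ b else -p.color₀ b) ∧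
    (∀ x, p.color₂ x = if x ≤ -(a + b + 1) then p.color₀ b else -p.color₀ b) := by
  rw [isUniformAt_up_iff] at h
  exact ⟨p.isLineColoring.eq_ite₀ (by ring) rfl h.1 h.2,
    p.isLineColoring.eq_ite₁ (by ring) rfl h.1 h.2, p.isLineColoring.eq_ite₂ (by ring) rfl h.1 h.2⟩

theorem IsUniformAt.color_eq_down {p : PauliPuzzle} {a b : ℤ} (h : p.IsUniformAt (down a b)) :
    (∀ x, p.color₀ x = if b + 1 ≤ x then p.color₀ (b + 1) else -p.color₀ (b + 1)) ∧
    (∀ x, p.color₁ x = if a + 1 ≤ x then p.color₀ (b + 1) else -p.color₀ (b + 1)) ∧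
    (∀ x, p.color₂ x = if -(a + b + 1) ≤ x then p.color₀ (b + 1) else -p.color₀ (b + 1)) := by
  rw [isUniformAt_down_iff] at h
  have hr := p.isLineColoring.reflect
  have hs : -(b + 1) + -(a + 1) + (a + b + 1) = -1 := by ring
  have r₀ := hr.eq_ite₀ hs (c := p.color₀ (b + 1)) (by simp) (by simpa using h.1)
    (by simpa using h.2)
  have r₁ := hr.eq_ite₁ hs (c := p.color₀ (b + 1)) (by simp) (by simpa using h.1)
    (by simpa using h.2)
  have r₂ := hr.eq_ite₂ hs (c := p.color₀ (b + 1)) (by simp) (by simpa using h.1)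
    (by simpa using h.2)
  refine ⟨fun x => ?_, fun x => ?_, fun x => ?_⟩
  · have := r₀ (-x)
    rw [neg_neg] at this
    simpa only [neg_le_neg_iff] using this
  · have := r₁ (-x)
    rw [neg_neg] at this
    simpa only [neg_le_neg_iff] using this
  · have := r₂ (-x)
    rw [neg_neg] at this
    simpa only [neg_le] using this

theorem _root_.ZMod.ite_eq_ite_iff {c : ZMod 3} (hc : c ≠ 0) {P Q : Prop} [Decidable P]
    [Decidable Q] : ((if P then c else -c) = if Q then c else -c) ↔ (P ↔ Q) := by
  have h : c ≠ -c := by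
    revert c
    decide
  by_cases P <;> by_cases Q <;> simp_all [h.symm]

theorem IsUniformAt.color_eq_iff_up {p : PauliPuzzle} {a b : ℤ} (h : p.IsUniformAt (up a b))
    (x y : ℤ) : (p.color₁ x = p.color₂ y ↔ (x ≤ a ↔ y ≤ -(a + b + 1))) ∧
      (p.color₀ x = p.color₂ y ↔ (x ≤ b ↔ y ≤ -(a + b + 1))) ∧
      (p.color₀ x = p.color₁ y ↔ (x ≤ b ↔ y ≤ a)) := by
  rw [h.color_eq_up.1 x, h.color_eq_up.2.1 x, h.color_eq_up.2.1 y, h.color_eq_up.2.2 y]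
  have hc := p.isLineColoring.ne₀ b
  exact ⟨ZMod.ite_eq_ite_iff hc, ZMod.ite_eq_ite_iff hc, ZMod.ite_eq_ite_iff hc⟩

theorem IsUniformAt.color_eq_iff_down {p : PauliPuzzle} {a b : ℤ} (h : p.IsUniformAt (down a b))
    (x y : ℤ) : (p.color₁ x = p.color₂ y ↔ (a + 1 ≤ x ↔ -(a + b + 1) ≤ y)) ∧
      (p.color₀ x = p.color₂ y ↔ (b + 1 ≤ x ↔ -(a + b + 1) ≤ y)) ∧
      (p.color₀ x = p.color₁ y ↔ (b + 1 ≤ x ↔ a + 1 ≤ y)) := by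
  rw [h.color_eq_down.1 x, h.color_eq_down.2.1 x, h.color_eq_down.2.1 y, h.color_eq_down.2.2 y]
  have hc := p.isLineColoring.ne₀ (b + 1)
  exact ⟨ZMod.ite_eq_ite_iff hc, ZMod.ite_eq_ite_iff hc, ZMod.ite_eq_ite_iff hc⟩

/-- Each class of lines switches colour once, at the uniform tile, so along a strip through it the
two crossing classes have opposite colours at every step except across that tile. -/
theorem IsUniformAt.eq_of_mark_strip_eq {p : PauliPuzzle} {d : Fin 3} {n k l : ℤ}
    (h : p.IsUniformAt (strip d n l))
    (hk : p.mark (strip d n k) = p.mark (strip d n (k + 2))) : l = k + 1 := by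
  obtain ⟨y, hl⟩ := Int.even_or_odd' l
  obtain ⟨x, rfl | rfl⟩ := Int.even_or_odd' k
  · obtain ⟨e₀, -, e₁, -, e₂, -⟩ := p.mark_strip_eq_iff n x
    fin_cases d
    · rcases hl with rfl | rfl
      · have := ((strip_zero_even n y ▸ h :).color_eq_iff_up _ _).1.1 (e₀.1 hk)
        omega
      · have := ((strip_zero_odd n y ▸ h :).color_eq_iff_down _ _).1.1 (e₀.1 hk)
        omega
    · rcases hl with rfl | rfl
      · have := ((strip_one_even n y ▸ h :).color_eq_iff_up _ _).2.1.1 (e₁.1 hk)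
        omega
      · have := ((strip_one_odd n y ▸ h :).color_eq_iff_down _ _).2.1.1 (e₁.1 hk)
        omega
    · rcases hl with rfl | rfl
      · have := ((strip_two_even n y ▸ h :).color_eq_iff_up _ _).2.2.1 (e₂.1 hk)
        omega
      · have := ((strip_two_odd n y ▸ h :).color_eq_iff_down _ _).2.2.1 (e₂.1 hk)
        omega
  · obtain ⟨-, e₀, -, e₁, -, e₂⟩ := p.mark_strip_eq_iff n x
    fin_cases d
    · rcases hl with rfl | rfl
      · have := ((strip_zero_even n y ▸ h :).color_eq_iff_up _ _).1.1 (e₀.1 hk)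
        omega
      · have := ((strip_zero_odd n y ▸ h :).color_eq_iff_down _ _).1.1 (e₀.1 hk)
        omega
    · rcases hl with rfl | rfl
      · have := ((strip_one_even n y ▸ h :).color_eq_iff_up _ _).2.1.1 (e₁.1 hk)
        omega
      · have := ((strip_one_odd n y ▸ h :).color_eq_iff_down _ _).2.1.1 (e₁.1 hk)
        omega
    · rcases hl with rfl | rfl
      · have := ((strip_two_even n y ▸ h :).color_eq_iff_up _ _).2.2.1 (e₂.1 hk)
        omega
      · have := ((strip_two_odd n y ▸ h :).color_eq_iff_down _ _).2.2.1 (e₂.1 hk)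
        omega

theorem IsUniformAt.isMPuzzle {p : PauliPuzzle} {t : Tile} (h : p.IsUniformAt t) :
    p.IsMPuzzle (p.mark t) := by
  refine ⟨t, rfl, ?_⟩
  rintro d n k rfl
  refine ⟨isTStripOn_iff.2 fun j hj _ _ heq => ?_, isTStripOn_iff.2 fun j _ _ hj heq => ?_, ?_⟩
  · have := h.eq_of_mark_strip_eq heq
    simp at hj
    omega
  · have := h.eq_of_mark_strip_eq heq
    simp at hj
    omega
  · obtain ⟨N, hN⟩ := h
    have h₁ := hN _ (adjacent_strip_pred d n k)
    have h₂ := hN _ (adjacent_strip_succ d n k)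
    obtain ⟨C, hC₁, hC₂⟩ := Pauli.exists_ne_ne N (p.mark (strip d n k))
    refine ⟨C, fun j hj => ?_⟩
    obtain ⟨hj₁, hj₂⟩ := hj
    obtain rfl | rfl | rfl : j = k - 1 ∨ j = k ∨ j = k + 1 := by omega
    · rwa [h₁]
    · exact hC₂
    · rwa [h₂]

/-- Strips of every direction pass through a uniform tile, and there the two outer tiles of the
centred triple agree. -/
theorem IsUnionOfParallelTStrips.not_isUniformAt {p : PauliPuzzle}
    (h : p.IsUnionOfParallelTStrips) (t : Tile) : ¬ p.IsUniformAt t := by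
  rintro ⟨N, hN⟩
  obtain ⟨d, hd⟩ := h
  obtain ⟨n, k, rfl⟩ := exists_strip_eq d t
  have h₁ := hN _ (adjacent_strip_pred d n k)
  have h₂ := hN _ (adjacent_strip_succ d n k)
  refine isTStripOn_iff.1 (hd n) (k - 1) trivial trivial trivial ?_
  rw [show k - 1 + 2 = k + 1 by ring, h₁, h₂]

theorem isUnionOfParallelTStrips_of_color {p : PauliPuzzle}
    (h : (∀ x y, p.color₁ x ≠ p.color₂ y) ∨ (∀ x y, p.color₀ x ≠ p.color₂ y) ∨
      ∀ x y, p.color₀ x ≠ p.color₁ y) : p.IsUnionOfParallelTStrips := by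
  rcases h with h | h | h
  · refine ⟨0, fun n => isTStripOn_iff.2 fun k _ _ _ heq => ?_⟩
    obtain ⟨x, rfl | rfl⟩ := Int.even_or_odd' k
    · exact h _ _ ((p.mark_strip_eq_iff n x).1.1 heq)
    · exact h _ _ ((p.mark_strip_eq_iff n x).2.1.1 heq)
  · refine ⟨1, fun n => isTStripOn_iff.2 fun k _ _ _ heq => ?_⟩
    obtain ⟨x, rfl | rfl⟩ := Int.even_or_odd' k
    · exact h _ _ ((p.mark_strip_eq_iff n x).2.2.1.1 heq)
    · exact h _ _ ((p.mark_strip_eq_iff n x).2.2.2.1.1 heq)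
  · refine ⟨2, fun n => isTStripOn_iff.2 fun k _ _ _ heq => ?_⟩
    obtain ⟨x, rfl | rfl⟩ := Int.even_or_odd' k
    · exact h _ _ ((p.mark_strip_eq_iff n x).2.2.2.2.1.1 heq)
    · exact h _ _ ((p.mark_strip_eq_iff n x).2.2.2.2.2.1 heq)

theorem isMPuzzle_or_isUnionOfParallelTStrips (p : PauliPuzzle) :
    (∃ M, p.IsMPuzzle M) ∨ p.IsUnionOfParallelTStrips := by
  by_cases h : ∃ t, p.IsUniformAt t
  · obtain ⟨t, ht⟩ := h
    exact Or.inl ⟨_, ht.isMPuzzle⟩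
  · right
    apply isUnionOfParallelTStrips_of_color
    apply p.isLineColoring.constant_pair
    rintro i j k (hs | hs) ⟨h₁, h₂⟩
    · refine h ⟨up j i, isUniformAt_up_iff.2 ⟨h₁, ?_⟩⟩
      rwa [show -(j + i + 1) = k by omega]
    · refine h ⟨down (j - 1) (i - 1), isUniformAt_down_iff.2 ?_⟩
      rw [sub_add_cancel, sub_add_cancel, show -(j - 1 + (i - 1) + 1) = k by omega]
      exact ⟨h₁, h₂⟩

end PauliPuzzle

/-! ### Isometries of the plane and symmetries of the tiling -/

theorem LatticeVertex.point_injective : Function.Injective LatticeVertex.point := by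
  rintro ⟨a, b⟩ ⟨c, d⟩ h
  rw [Complex.ext_iff] at h
  obtain ⟨h₁, h₂⟩ := h
  have hs : (Real.sqrt 3 / 2) ≠ 0 := by positivity
  have hb : (b : ℝ) = d := mul_right_cancel₀ hs h₂
  have ha : (a : ℝ) = c := by
    simp only [LatticeVertex.point] at h₁
    rw [hb] at h₁
    linarith
  rw [Prod.mk.injEq]
  exact ⟨by exact_mod_cast ha, by exact_mod_cast hb⟩

theorem LatticeVertex.point_add (v w : LatticeVertex) : (v + w).point = v.point + w.point := by
  apply Complex.ext <;> simp [LatticeVertex.point] <;> ring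

theorem LatticeVertex.point_neg (v : LatticeVertex) : (-v).point = -v.point := by
  apply Complex.ext <;> simp [LatticeVertex.point] <;> ring

theorem Complex.eq_of_dist_eq {z w : ℂ} (h₀ : dist w 0 = dist z 0) (h₁ : dist w 1 = dist z 1)
    (h₂ : dist w (LatticeVertex.point (0, 1)) = dist z (LatticeVertex.point (0, 1))) : w = z := by
  rw [Complex.dist_eq_re_im, Complex.dist_eq_re_im,
    Real.sqrt_inj (by positivity) (by positivity)] at h₀ h₁ h₂
  have hs : 0 < Real.sqrt 3 := by positivity
  simp only [LatticeVertex.point, Complex.zero_re, Complex.zero_im, Complex.one_re,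
    Complex.one_im, Int.cast_zero, Int.cast_one] at h₀ h₁ h₂
  have hre : w.re = z.re := by linarith
  refine Complex.ext hre ?_
  rw [hre] at h₀ h₂
  have : Real.sqrt 3 * w.im = Real.sqrt 3 * z.im := by linarith
  exact mul_left_cancel₀ hs.ne' this

/-- An isometry of the plane is determined by its values at three noncollinear points. -/
theorem Complex.isometryEquiv_ext {f g : ℂ ≃ᵢ ℂ} (h₀ : f 0 = g 0) (h₁ : f 1 = g 1)
    (h₂ : f (LatticeVertex.point (0, 1)) = g (LatticeVertex.point (0, 1))) : f = g := by
  ext1 z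
  rw [← g.symm_apply_eq]
  have key : ∀ x, f x = g x → dist (g.symm (f z)) x = dist z x := by
    intro x hx
    rw [← g.dist_eq, g.apply_symm_apply, ← hx, f.dist_eq]
  exact Complex.eq_of_dist_eq (key 0 h₀) (key 1 h₁) (key _ h₂)

namespace Tile

theorem cornerPoints_injective : Function.Injective cornerPoints := by
  intro s t h
  have hc : s.corners = t.corners := by
    have := Set.image_injective.2 LatticeVertex.point_injective h
    exact_mod_cast this
  rw [Finset.ext_iff] at hc
  rcases s with ⟨a, b⟩ | ⟨a, b⟩ <;> rcases t with ⟨c, d⟩ | ⟨c, d⟩ <;>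
    simp only [corners, Finset.mem_insert, Finset.mem_singleton, Prod.forall, Prod.mk.injEq] at hc
  · have h₁ := hc a b
    have h₂ := hc (a + 1) b
    have h₃ := hc a (b + 1)
    rw [show a = c by omega, show b = d by omega]
  · have h₁ := hc a b
    have h₂ := hc (a + 1) b
    have h₃ := hc a (b + 1)
    omega
  · have h₁ := hc (a + 1) b
    have h₂ := hc a (b + 1)
    have h₃ := hc (a + 1) (b + 1)
    omega
  · have h₁ := hc (a + 1) b
    have h₂ := hc a (b + 1)
    have h₃ := hc (a + 1) (b + 1)
    rw [show a = c by omega, show b = d by omega]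

/-- Counting common corner points is invariant under any bijection of the plane, hence isomorphisms
preserve adjacency. -/
theorem adjacent_iff_ncard {s t : Tile} :
    s.Adjacent t ↔ (s.cornerPoints ∩ t.cornerPoints).ncard = 2 := by
  rw [cornerPoints, cornerPoints, ← Set.image_inter LatticeVertex.point_injective,
    Set.ncard_image_of_injective _ LatticeVertex.point_injective, ← Finset.coe_inter,
    Set.ncard_coe_finset, Adjacent]

theorem adjacent_map_iff {f : ℂ ≃ᵢ ℂ} {σ : Tile ≃ Tile}
    (h : ∀ t, f '' t.cornerPoints = (σ t).cornerPoints) {s t : Tile} :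
    (σ s).Adjacent (σ t) ↔ s.Adjacent t := by
  rw [adjacent_iff_ncard, adjacent_iff_ncard, ← h, ← h, ← Set.image_inter f.injective,
    Set.ncard_image_of_injective _ f.injective]

/-- Translation of tiles by a lattice vector. -/
def shift (c d : ℤ) : Tile ≃ Tile where
  toFun
    | up a b => up (a + c) (b + d)
    | down a b => down (a + c) (b + d)
  invFun
    | up a b => up (a - c) (b - d)
    | down a b => down (a - c) (b - d)
  left_inv t := by cases t <;> simp
  right_inv t := by cases t <;> simp

/-- The half turn of the tiling around the origin. -/
def halfTurn : Tile ≃ Tile where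
  toFun
    | up a b => down (-a - 1) (-b - 1)
    | down a b => up (-a - 1) (-b - 1)
  invFun
    | up a b => down (-a - 1) (-b - 1)
    | down a b => up (-a - 1) (-b - 1)
  left_inv t := by cases t <;> simp
  right_inv t := by cases t <;> simp

theorem image_cornerPoints_shift (c d : ℤ) (t : Tile) :
    IsometryEquiv.addRight (LatticeVertex.point (c, d)) '' t.cornerPoints =
      (shift c d t).cornerPoints := by
  have h : (shift c d t).corners = t.corners.image (· + (c, d)) := by
    cases t <;> simp [shift, corners, Finset.image_insert, add_right_comm]
  rw [cornerPoints, cornerPoints, h, Finset.coe_image, Set.image_image, Set.image_image]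
  refine Set.image_congr fun v _ => ?_
  rw [LatticeVertex.point_add]
  rfl

theorem image_cornerPoints_halfTurn (t : Tile) :
    IsometryEquiv.neg ℂ '' t.cornerPoints = (halfTurn t).cornerPoints := by
  have h : (halfTurn t).corners = t.corners.image (fun v => -v) := by
    cases t <;> ext ⟨x, y⟩ <;>
      simp only [halfTurn, corners, Finset.image_insert, Finset.image_singleton, Prod.neg_mk,
        Finset.mem_insert, Finset.mem_singleton, Prod.mk.injEq, Equiv.coe_fn_mk] <;>
      omega
  rw [cornerPoints, cornerPoints, h, Finset.coe_image, Set.image_image, Set.image_image]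
  refine Set.image_congr fun v _ => ?_
  rw [LatticeVertex.point_neg]
  rfl

end Tile

/-! ### Isomorphisms and uniform tiles -/

namespace PauliPuzzle

theorem Isomorphic.refl (p : PauliPuzzle) : p.Isomorphic p :=
  ⟨IsometryEquiv.refl ℂ, Equiv.refl Tile, fun _ => Set.image_id _, fun _ => rfl⟩

theorem Isomorphic.symm {p q : PauliPuzzle} (h : p.Isomorphic q) : q.Isomorphic p := by
  obtain ⟨f, σ, h, hm⟩ := h
  refine ⟨f.symm, σ.symm, fun t => ?_, fun t => ?_⟩
  · have := h (σ.symm t)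
    rw [σ.apply_symm_apply] at this
    rw [← this, Set.image_image]
    simp
  · rw [← hm, σ.apply_symm_apply]

theorem Isomorphic.trans {p q r : PauliPuzzle} (h : p.Isomorphic q) (h' : q.Isomorphic r) :
    p.Isomorphic r := by
  obtain ⟨f, σ, h, hm⟩ := h
  obtain ⟨g, τ, h', hm'⟩ := h'
  refine ⟨f.trans g, σ.trans τ, fun t => ?_, fun t => ?_⟩
  · rw [Equiv.trans_apply, ← h', ← h, Set.image_image]
    rfl
  · rw [Equiv.trans_apply, hm', hm]

/-- The puzzle carried to a given one by a symmetry of the tiling. -/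
def pullback (p : PauliPuzzle) (f : ℂ ≃ᵢ ℂ) (σ : Tile ≃ Tile)
    (h : ∀ t, f '' t.cornerPoints = (σ t).cornerPoints)
    (hp : ∀ v, ((around v).map fun t => (p.mark (σ t)).toMatrix).prod = 1) : PauliPuzzle where
  mark t := p.mark (σ t)
  mark_ne _ _ hst := p.mark_ne _ _ ((adjacent_map_iff h).2 hst)
  prod_around := hp

theorem exists_isomorphic_shift (p : PauliPuzzle) (c d : ℤ) :
    ∃ q : PauliPuzzle, q.Isomorphic p ∧ ∀ t, q.mark t = p.mark (shift c d t) := by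
  refine ⟨p.pullback _ _ (image_cornerPoints_shift c d) ?_,
    ⟨_, _, image_cornerPoints_shift c d, fun _ => rfl⟩, fun _ => rfl⟩
  rintro ⟨a, b⟩
  rw [← p.prod_around (a + c, b + d)]
  simp [around, shift, sub_add_eq_add_sub]

theorem exists_isomorphic_halfTurn (p : PauliPuzzle) :
    ∃ q : PauliPuzzle, q.Isomorphic p ∧ ∀ t, q.mark t = p.mark (halfTurn t) := by
  refine ⟨p.pullback _ _ image_cornerPoints_halfTurn ?_,
    ⟨_, _, image_cornerPoints_halfTurn, fun _ => rfl⟩, fun _ => rfl⟩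
  rintro ⟨a, b⟩
  have h := p.prod_around (-a, -b)
  simp only [around, List.map_cons, List.map_nil, List.prod_cons, List.prod_nil, mul_one] at h
  -- The half turn rotates the cyclic order by three tiles, so the two halves of the product are
  -- swapped.
  rw [← mul_assoc, ← mul_assoc, mul_eq_one_comm] at h
  simp only [around, List.map_cons, List.map_nil, List.prod_cons, List.prod_nil, mul_one, halfTurn,
    Equiv.coe_fn_mk, neg_sub, sub_sub_cancel_left]
  simpa [mul_assoc, show 1 - a - 1 = -a by ring, show 1 - b - 1 = -b by ring] using h

theorem IsUniformAt.map {p q : PauliPuzzle} {f : ℂ ≃ᵢ ℂ} {σ : Tile ≃ Tile}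
    (h : ∀ t, f '' t.cornerPoints = (σ t).cornerPoints) (hm : ∀ t, q.mark (σ t) = p.mark t)
    {t : Tile} (ht : p.IsUniformAt t) : q.IsUniformAt (σ t) := by
  obtain ⟨N, hN⟩ := ht
  refine ⟨N, fun s hs => ?_⟩
  rw [← σ.apply_symm_apply s] at hs ⊢
  rw [hm]
  exact hN _ ((adjacent_map_iff h).1 hs)

theorem Isomorphic.exists_isUniformAt {p q : PauliPuzzle} (h : p.Isomorphic q) {t : Tile}
    (ht : p.IsUniformAt t) : ∃ t', q.IsUniformAt t' ∧ q.mark t' = p.mark t := by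
  obtain ⟨f, σ, h, hm⟩ := h
  exact ⟨σ t, ht.map h hm, hm t⟩

/-- Isomorphic puzzles agree at their uniform tiles and on the neighbours of these tiles. -/
theorem Isomorphic.mark_eq {p q : PauliPuzzle} (h : p.Isomorphic q) {s t : Tile}
    (hs : p.IsUniformAt s) (ht : q.IsUniformAt t) : p.mark s = q.mark t ∧
      ∀ s' t', s.Adjacent s' → t.Adjacent t' → p.mark s' = q.mark t' := by
  obtain ⟨f, σ, h, hm⟩ := h
  obtain rfl := (hs.map h hm).unique ht
  refine ⟨(hm s).symm, fun s' t' hs' ht' => ?_⟩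
  obtain ⟨N, hN⟩ := ht
  rw [hN t' ht', ← hm, hN _ ((adjacent_map_iff h).2 hs')]

/-- Every puzzle with a uniform tile can be moved so that this tile is at the origin. -/
theorem IsUniformAt.exists_isomorphic {p : PauliPuzzle} {t : Tile} (h : p.IsUniformAt t) :
    ∃ q : PauliPuzzle, p.Isomorphic q ∧ q.IsUniformAt (up 0 0) := by
  have key : ∀ (p : PauliPuzzle) (a b : ℤ), p.IsUniformAt (up a b) →
      ∃ q : PauliPuzzle, p.Isomorphic q ∧ q.IsUniformAt (up 0 0) := by
    intro p a b h
    obtain ⟨q, hq, hm⟩ := p.exists_isomorphic_shift a b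
    refine ⟨q, hq.symm, ?_⟩
    have := h.map (σ := (shift a b).symm) (f := (IsometryEquiv.addRight (LatticeVertex.point (a, b))).symm) (q := q)
      (fun t => by
        have := image_cornerPoints_shift a b ((shift a b).symm t)
        rw [Equiv.apply_symm_apply] at this
        rw [← this, Set.image_image]
        simp)
      (fun t => by rw [hm, Equiv.apply_symm_apply])
    simpa [shift] using this
  rcases t with ⟨a, b⟩ | ⟨a, b⟩
  · exact key p a b h
  · obtain ⟨q, hq, hm⟩ := p.exists_isomorphic_halfTurn
    have hu : q.IsUniformAt (halfTurn (down a b)) :=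
      h.map (σ := halfTurn) image_cornerPoints_halfTurn
        (fun t => by rw [hm]; cases t <;> simp [halfTurn])
    obtain ⟨r, hr, hr'⟩ := key q _ _ hu
    exact ⟨r, hq.symm.trans hr, hr'⟩

/-! ### Classification of the M-puzzles -/

section ofPotential

variable {G₀ G₁ G₂ : ℤ → ZMod 3}
  (h : IsLineColoring (fun i => G₀ i - G₀ (i - 1)) (fun i => G₁ i - G₁ (i - 1))
    (fun i => G₂ (-i) - G₂ (-i - 1)))

theorem val_ofPotential_up (a b : ℤ) :
    (ofPotential G₀ G₁ G₂ h).val (up a b) = G₂ (a + b) - G₁ a - G₀ b :=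
  Pauli.code_ofCode _

theorem val_ofPotential_down (a b : ℤ) :
    (ofPotential G₀ G₁ G₂ h).val (down a b) = G₂ (a + b + 1) - G₁ a - G₀ b :=
  Pauli.code_ofCode _

theorem color₀_ofPotential (i : ℤ) :
    (ofPotential G₀ G₁ G₂ h).color₀ i = G₀ i - G₀ (i - 1) := by
  rw [color₀, val_ofPotential_up, val_ofPotential_down, show 0 + (i - 1) + 1 = 0 + i by ring]
  ring

theorem color₁_ofPotential (i : ℤ) :
    (ofPotential G₀ G₁ G₂ h).color₁ i = G₁ i - G₁ (i - 1) := by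
  rw [color₁, val_ofPotential_up, val_ofPotential_down, show i - 1 + 0 + 1 = i + 0 by ring]
  ring

theorem color₂_ofPotential (i : ℤ) :
    (ofPotential G₀ G₁ G₂ h).color₂ i = G₂ (-i) - G₂ (-i - 1) := by
  rw [color₂, val_ofPotential_up, val_ofPotential_down,
    show 0 + (-i - 1) + 1 = -i by ring, show 0 + (-i - 1) = -i - 1 by ring]
  ring

end ofPotential

/-- A multiple of the absolute value has increments that switch sign once, which is the pattern
forced around a uniform tile at the origin. -/
theorem abs_increment (c : ZMod 3) (i : ℤ) :
    -c * (|i| : ℤ) - -c * (|i - 1| : ℤ) = if i ≤ 0 then c else -c := by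
  split_ifs with hi
  · rw [abs_of_nonpos hi, abs_of_nonpos (by omega)]
    push_cast
    ring
  · rw [abs_of_pos (by omega), abs_of_nonneg (by omega)]
    push_cast
    ring

theorem abs_increment_neg (m c : ZMod 3) (i : ℤ) :
    m + c * (|-i| : ℤ) - (m + c * (|-i - 1| : ℤ)) = if i ≤ -1 then c else -c := by
  rw [show -i - 1 = -(i + 1) by ring, abs_neg, abs_neg]
  split_ifs with hi
  · rw [abs_of_nonpos (by omega : i ≤ 0), abs_of_nonpos (by omega)]
    push_cast
    ring
  · rw [abs_of_nonneg (by omega : 0 ≤ i), abs_of_nonneg (by omega)]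
    push_cast
    ring

/-- The puzzle with a uniform tile at the origin, with the given numbers on this tile and across its
edges. -/
def star (m c : ZMod 3) (hc : c ≠ 0) : PauliPuzzle :=
  ofPotential (fun i => -c * (|i| : ℤ)) (fun i => -c * (|i| : ℤ)) (fun i => m + c * (|i| : ℤ)) (by
    simp only [abs_increment, abs_increment_neg]
    have hne : ∀ P : Prop, [Decidable P] → (if P then c else -c) ≠ 0 := by
      intro P _
      split_ifs
      exacts [hc, neg_ne_zero.2 hc]
    refine ⟨fun _ => hne _, fun _ => hne _, fun _ => hne _, fun i j k hs => ?_⟩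
    have h₁ : c + c + -c ≠ 0 := by rwa [add_neg_cancel_right]
    have h₂ : c + -c + -c ≠ 0 := by rw [add_neg_cancel, zero_add]; exact neg_ne_zero.2 hc
    split_ifs <;> first
      | omega
      | exact h₁
      | exact h₂
      | (rw [show c + -c + c = c + c + -c by ring]; exact h₁)
      | (rw [show -c + c + c = c + c + -c by ring]; exact h₁)
      | (rw [show -c + c + -c = c + -c + -c by ring]; exact h₂)
      | (rw [show -c + -c + c = c + -c + -c by ring]; exact h₂))

theorem star_color₀ (m c : ZMod 3) (hc : c ≠ 0) (i : ℤ) :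
    (star m c hc).color₀ i = if i ≤ 0 then c else -c :=
  (color₀_ofPotential _ i).trans (abs_increment c i)

theorem star_color₁ (m c : ZMod 3) (hc : c ≠ 0) (i : ℤ) :
    (star m c hc).color₁ i = if i ≤ 0 then c else -c :=
  (color₁_ofPotential _ i).trans (abs_increment c i)

theorem star_color₂ (m c : ZMod 3) (hc : c ≠ 0) (i : ℤ) :
    (star m c hc).color₂ i = if i ≤ -1 then c else -c :=
  (color₂_ofPotential _ i).trans (abs_increment_neg m c i)

theorem star_val_up (m c : ZMod 3) (hc : c ≠ 0) : (star m c hc).val (up 0 0) = m := by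
  rw [star, val_ofPotential_up]
  simp

theorem star_val_down (m c : ZMod 3) (hc : c ≠ 0) : (star m c hc).val (down 0 0) = m + c := by
  rw [star, val_ofPotential_down]
  simp

theorem star_isUniformAt (m c : ZMod 3) (hc : c ≠ 0) : (star m c hc).IsUniformAt (up 0 0) := by
  rw [isUniformAt_up_iff, star_color₀, star_color₁, star_color₂]
  simp

theorem IsUniformAt.eq_star {p : PauliPuzzle} (h : p.IsUniformAt (up 0 0)) :
    p = star (p.val (up 0 0)) (p.color₀ 0) (p.isLineColoring.ne₀ 0) := by
  obtain ⟨h₀, h₁, h₂⟩ := h.color_eq_up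
  apply eq_of_color_eq
  · funext x
    rw [h₀, star_color₀]
  · funext x
    rw [h₁, star_color₁]
  · funext x
    rw [h₂, star_color₂]
    simp
  · rw [← val_eq_val_iff, star_val_up]

theorem star_isMPuzzle (M : Pauli) (c : ZMod 3) (hc : c ≠ 0) :
    (star M.code c hc).IsMPuzzle M := by
  have h := (star_isUniformAt M.code c hc).isMPuzzle
  rwa [Pauli.code_injective (star_val_up M.code c hc)] at h

theorem star_not_isomorphic (m : ZMod 3) {c c' : ZMod 3} (hc : c ≠ 0) (hc' : c' ≠ 0)
    (h : c ≠ c') : ¬ (star m c hc).Isomorphic (star m c' hc') := by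
  intro hiso
  have hadj : (up 0 0).Adjacent (down 0 0) := by simp [adjacent_up_down_iff]
  have := (hiso.mark_eq (star_isUniformAt m c hc) (star_isUniformAt m c' hc')).2 _ _ hadj hadj
  rw [← val_eq_val_iff, star_val_down, star_val_down] at this
  exact h (add_left_cancel this)

theorem IsMPuzzle.isomorphic_star {p : PauliPuzzle} {M : Pauli} (h : p.IsMPuzzle M) :
    ∃ (c : ZMod 3) (hc : c ≠ 0), p.Isomorphic (star M.code c hc) := by
  obtain ⟨t, rfl, ht⟩ := h.exists_isUniformAt
  obtain ⟨q, hq, hu⟩ := ht.exists_isomorphic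
  refine ⟨q.color₀ 0, q.isLineColoring.ne₀ 0, ?_⟩
  have hm : (p.mark t).code = q.val (up 0 0) := by rw [(hq.mark_eq ht hu).1, val]
  rw [hm, ← hu.eq_star]
  exact hq

/-! ### Infinitely many unions of parallel T-strips -/

/-- The isometry determines the isomorphic copy, and is itself determined by the images of the three
corners of one tile, which are lattice points. -/
theorem countable_isomorphic (p : PauliPuzzle) : {q | p.Isomorphic q}.Countable := by
  have key : ∀ q : {q | p.Isomorphic q}, ∃ v : LatticeVertex × LatticeVertex × LatticeVertex,
      ∃ (f : ℂ ≃ᵢ ℂ) (σ : Tile ≃ Tile), (∀ t, f '' t.cornerPoints = (σ t).cornerPoints) ∧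
        (∀ t, q.1.mark (σ t) = p.mark t) ∧ f 0 = v.1.point ∧ f 1 = v.2.1.point ∧
        f (LatticeVertex.point (0, 1)) = v.2.2.point := by
    rintro ⟨q, f, σ, h, hm⟩
    have hv : ∀ w ∈ (up 0 0).corners, ∃ v : LatticeVertex, f w.point = v.point := by
      intro w hw
      have : f w.point ∈ (σ (up 0 0)).cornerPoints := by
        rw [← h]
        exact Set.mem_image_of_mem _ (Set.mem_image_of_mem _ hw)
      obtain ⟨v, -, hv⟩ := this
      exact ⟨v, hv.symm⟩
    obtain ⟨v₀, h₀⟩ := hv (0, 0) (by simp [corners])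
    obtain ⟨v₁, h₁⟩ := hv (1, 0) (by simp [corners])
    obtain ⟨v₂, h₂⟩ := hv (0, 1) (by simp [corners])
    refine ⟨(v₀, v₁, v₂), f, σ, h, hm, ?_, ?_, h₂⟩
    · rw [← h₀]
      congr 1
      apply Complex.ext <;> simp [LatticeVertex.point]
    · rw [← h₁]
      congr 1
      apply Complex.ext <;> simp [LatticeVertex.point]
  choose v hv using key
  refine Set.countable_coe_iff.1 (Function.Injective.countable (f := v) ?_)
  intro q q' hqq
  obtain ⟨f, σ, h, hm, h₀, h₁, h₂⟩ := hv q
  obtain ⟨f', σ', h', hm', h₀', h₁', h₂'⟩ := hv q'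
  obtain rfl : f = f' := Complex.isometryEquiv_ext (by rw [h₀, h₀', hqq]) (by rw [h₁, h₁', hqq])
    (by rw [h₂, h₂', hqq])
  obtain rfl : σ = σ' := Equiv.ext fun t => cornerPoints_injective (by rw [← h, ← h'])
  apply Subtype.ext
  ext t
  rw [← σ.apply_symm_apply t, hm, hm']

open Classical in
/-- The potential with values `±1` at the even integers, the set `S` telling the sign, and `0` at the
odd integers. -/
noncomputable def stripePotential (S : Set ℤ) (i : ℤ) : ZMod 3 :=
  if Even i then (if i / 2 ∈ S then 1 else -1) else 0

theorem stripePotential_sub_ne_zero (S : Set ℤ) (i : ℤ) :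
    stripePotential S i - stripePotential S (i - 1) ≠ 0 := by
  have h₁ : (1 : ZMod 3) ≠ 0 := by decide
  have h₂ : (-1 : ZMod 3) ≠ 0 := by decide
  have hev : Even (i - 1) ↔ ¬ Even i := by simp
  unfold stripePotential
  by_cases hi : Even i
  · rw [if_pos hi, if_neg (c := Even (i - 1)) (fun h => hev.1 h hi), sub_zero]
    split_ifs
    exacts [h₁, h₂]
  · rw [if_neg hi, if_pos (hev.2 hi), zero_sub, neg_ne_zero]
    split_ifs
    exacts [h₁, h₂]

/-- A union of parallel T-strips with prescribed colours of the lines parallel to the strips. -/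
noncomputable def stripes (S : Set ℤ) : PauliPuzzle :=
  ofPotential (stripePotential S) (fun i => (i : ZMod 3)) (fun i => -(i : ZMod 3))
    { ne₀ := stripePotential_sub_ne_zero S
      ne₁ := fun i => by push_cast; rw [sub_sub_cancel]; decide
      ne₂ := fun i => by
        push_cast
        rw [show -(-(i : ZMod 3)) - -(-(i : ZMod 3) - 1) = -1 by ring]
        decide
      -- The other two colours are 1 and -1 and cancel, so the horizontal lines may have any nonzero
      -- colours.
      sum_ne := fun i j k _ => by
        convert stripePotential_sub_ne_zero S i using 1
        push_cast
        ring }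

theorem stripes_isUnionOfParallelTStrips (S : Set ℤ) :
    (stripes S).IsUnionOfParallelTStrips := by
  apply isUnionOfParallelTStrips_of_color
  left
  intro x y
  rw [stripes, color₁_ofPotential, color₂_ofPotential]
  push_cast
  rw [sub_sub_cancel, show -(-(y : ZMod 3)) - -(-(y : ZMod 3) - 1) = -1 by ring]
  decide

theorem stripes_injective : Function.Injective stripes := by
  intro S T h
  ext n
  have hn := congrArg (fun p => p.val (up 0 (2 * n))) h
  simp only [stripes, val_ofPotential_up, sub_right_inj, stripePotential, even_two, Even.mul_right,
    if_true, Int.mul_ediv_cancel_left n (two_ne_zero)] at hn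
  have h₁ : (1 : ZMod 3) ≠ -1 := by decide
  by_cases hS : n ∈ S <;> by_cases hT : n ∈ T <;> simp_all [h₁.symm]

/-- Isomorphism of the puzzles `stripes S`. -/
def stripesSetoid : Setoid (Set ℤ) where
  r S T := (stripes S).Isomorphic (stripes T)
  iseqv := ⟨fun _ => Isomorphic.refl _, Isomorphic.symm, Isomorphic.trans⟩

/-- Finitely many classes, each countable, could not exhaust the uncountable family indexed by
subsets of ℤ. -/
theorem infinite_quotient_stripesSetoid : Infinite (Quotient stripesSetoid) := by
  by_contra hfin
  rw [not_infinite_iff_finite] at hfin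
  have hcov : (Set.univ : Set (Set ℤ)) =
      ⋃ x : Quotient stripesSetoid, stripes ⁻¹' {q | (stripes x.out).Isomorphic q} := by
    refine (Set.eq_univ_of_forall fun S => Set.mem_iUnion.2 ⟨Quotient.mk _ S, ?_⟩).symm
    exact Quotient.mk_out (s := stripesSetoid) S
  have : (Set.univ : Set (Set ℤ)).Countable := by
    rw [hcov]
    exact Set.countable_iUnion fun x => (countable_isomorphic _).preimage stripes_injective
  have := Set.countable_univ_iff.1 this
  obtain ⟨f, hf⟩ := exists_injective_nat (Set ℤ)
  exact Function.cantor_injective (fun S => (f S : ℤ)) (Nat.cast_injective.comp hf)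

end PauliPuzzle

open PauliPuzzle

theorem mainTheorem1 :
    -- every puzzle is of one of the two kinds
    (∀ p : PauliPuzzle, (∃ M : Pauli, p.IsMPuzzle M) ∨ p.IsUnionOfParallelTStrips) ∧
    -- the four families are pairwise disjoint, even up to isomorphism
    (∀ (p q : PauliPuzzle) (M : Pauli), p.IsMPuzzle M → q.IsUnionOfParallelTStrips →
      ¬ p.Isomorphic q) ∧
    (∀ (p q : PauliPuzzle) (M N : Pauli), p.IsMPuzzle M → q.IsMPuzzle N →
      p.Isomorphic q → M = N) ∧
    -- for each of the three matrices `M` there are exactly two `M`-puzzles up to isomorphism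
    (∀ M : Pauli, ∃ p q : PauliPuzzle, p.IsMPuzzle M ∧ q.IsMPuzzle M ∧ ¬ p.Isomorphic q ∧
      ∀ r : PauliPuzzle, r.IsMPuzzle M → r.Isomorphic p ∨ r.Isomorphic q) ∧
    -- there are infinitely many pairwise nonisomorphic unions of parallel T-strips
    (∃ F : ℕ → PauliPuzzle, (∀ i, (F i).IsUnionOfParallelTStrips) ∧
      ∀ i j, i ≠ j → ¬ (F i).Isomorphic (F j)) := by
  refine ⟨isMPuzzle_or_isUnionOfParallelTStrips, ?_, ?_, ?_, ?_⟩
  · intro p q M hp hq hiso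
    obtain ⟨t, -, ht⟩ := hp.exists_isUniformAt
    obtain ⟨t', ht', -⟩ := hiso.exists_isUniformAt ht
    exact hq.not_isUniformAt t' ht'
  · intro p q M N hp hq hiso
    obtain ⟨s, rfl, hs⟩ := hp.exists_isUniformAt
    obtain ⟨t, rfl, ht⟩ := hq.exists_isUniformAt
    exact (hiso.mark_eq hs ht).1
  · intro M
    have h₁ : (1 : ZMod 3) ≠ 0 := by decide
    have h₂ : (-1 : ZMod 3) ≠ 0 := by decide
    refine ⟨star M.code 1 h₁, star M.code (-1) h₂, star_isMPuzzle M 1 h₁,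
      star_isMPuzzle M (-1) h₂, star_not_isomorphic M.code h₁ h₂ (by decide), fun r hr => ?_⟩
    obtain ⟨c, hc, hiso⟩ := hr.isomorphic_star
    have hcases : ∀ c : ZMod 3, c ≠ 0 → c = 1 ∨ c = -1 := by decide
    rcases hcases c hc with rfl | rfl
    exacts [Or.inl hiso, Or.inr hiso]
  · have := infinite_quotient_stripesSetoid
    let e := Infinite.natEmbedding (Quotient stripesSetoid)
    refine ⟨fun i => stripes (e i).out, fun i => stripes_isUnionOfParallelTStrips _,
      fun i j hij hiso => hij (e.injective ?_)⟩
    rw [← Quotient.out_eq (e i), ← Quotient.out_eq (e j)]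
    exact Quotient.sound hiso
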